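/- Let $p$ be a prime, $P$ a finite $p$-group, and $\mathcal{F}$ an abstract Frobenius category (saturated fusion system) over $P$. Thus $\mathcal{F}$ is a category whose objects are the subgroups of $P$, whose morphisms are injective group homomorphisms, which contains all homomorphisms $H \to K$ that are restrictions of inner automorphisms of $P$, in which every morphism is an isomorphism of $\mathcal{F}$ followed by an inclusion, and which is saturated: every fully normalized subgroup $H$ is fully centralized with $\mathrm{Aut}_P(H)$ a Sylow $p$-subgroup of $\mathrm{Aut}_{\mathcal{F}}(H)$, and every isomorphism $\varphi\colon H \to K$ of $\mathcal{F}$ with $K$ fully centralized extends to a morphism $N_\varphi \to P$ of $\mathcal{F}$, where $N_\varphi = \{g \in N_P(H) \mid \varphi c_g \varphi^{-1} \in \mathrm{Aut}_P(K)\}$ and $c_g$ is conjugation with $g$. (A subgroup $H$ is fully centralized, respectively fully normalized, if $|C_P(H)| \ge |C_P(H')|$, respectively $|N_P(H)| \ge |N_P(H')|$, for all $H'$ isomorphic to $H$ in $\mathcal{F}$.) Let $\mathcal{F}^*$ be the full subcategory of $\mathcal{F}$ generated by the nonidentity subgroups of $P$, and write $\mathcal{F}(H,K)$, or $\mathcal{F}^*(H,K)$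 when $H$ and $K$ are nonidentity, for the set of morphisms from $H$ to $K$, and $\mathcal{F}^*(K) = \mathcal{F}^*(K,K)$. Let $\mu(K) = \mu(1,K)$ be the Möbius function of the poset of all subgroups of $P$. A weighting (coweighting) for a finite category $\mathcal{C}$ is a function $k^\bullet$ ($k_\bullet$) from the objects of $\mathcal{C}$ to $\mathbf{Q}$ such that $\sum_b |\mathcal{C}(a,b)|\,k^b = 1$ for all $a$ (such that $\sum_a k_a\,|\mathcal{C}(a,b)| = 1$ for all $b$). The category $\mathcal{C}$ has Euler characteristic if it admits both a weighting and a coweighting, and then $\chi(\mathcal{C}) = \sum_b k^b = \sum_a k_a$ for any weighting and any coweighting. Then the function $$k_K = \frac{-\mu(K)}{|\mathcal{F}^*(K,P)|}, \qquad K \in \mathrm{Ob}(\mathcal{F}^*),$$ is a coweighting for $\mathcal{F}^*$. The category $\mathcal{F}^*$ has Euler characteristic, and $$\chi(\mathcal{F}^*) = \sum_{[K]} \frac{-\mu(K)}{|\mathcal{F}^*(K)|},$$ where the sum runs over the isomorphism classes $[K]$ of objects of $\mathcal{F}^*$ and each summand may be computed with any representative $K$ of its class. Moreover $\chi(\mathcal{F}^*)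 \in \mathbf{Z}_{(p)}$, that is, $\chi(\mathcal{F}^*)$ is a $p$-local integer. -/

import Mathlib

open CategoryTheory

/-! ### Weightings, coweightings and the Euler characteristic of a finite category -/

section EulerCharacteristic

/-- The `ζ`-matrix `(|C(a, b)|)_{a, b}` of a category with finite morphism sets. -/
noncomputable def zetaMatrix (C : Type*) [Category C] : Matrix C C ℚ :=
  fun a b => (Nat.card (a ⟶ b) : ℚ)

/-- A weighting for the square matrix `ζ` : a column vector `k` with `ζ k = (1, …, 1)`. -/
def IsMatrixWeighting {S : Type*} [Fintype S] (ζ : Matrix S S ℚ) (k : S → ℚ) : Prop :=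
  ∀ a, ∑ b, ζ a b * k b = 1

/-- A coweighting for the square matrix `ζ` : a row vector `k` with `k ζ = (1, …, 1)`. -/
def IsMatrixCoweighting {S : Type*} [Fintype S] (ζ : Matrix S S ℚ) (k : S → ℚ) : Prop :=
  ∀ b, ∑ a, k a * ζ a b = 1

/-- A weighting for a finite category: a weighting for its `ζ`-matrix. -/
def IsWeighting (C : Type*) [Category C] [Fintype C] (k : C → ℚ) : Prop :=
  IsMatrixWeighting (zetaMatrix C) k

/-- A coweighting for a finite category: a coweighting for its `ζ`-matrix. -/
def IsCoweighting (C : Type*) [Category C] [Fintype C] (k : C → ℚ) : Prop :=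
  IsMatrixCoweighting (zetaMatrix C) k

/-- A finite category has Euler characteristic if it admits both a weighting and a
coweighting. -/
def HasEulerChar (C : Type*) [Category C] [Fintype C] : Prop :=
  (∃ k, IsWeighting C k) ∧ (∃ k, IsCoweighting C k)

open Classical in
/-- The Euler characteristic of a finite category that has one: the sum of the values of any
weighting or of any coweighting (see `eulerChar_eq_sum_weighting` and
`eulerChar_eq_sum_coweighting`). The value is `0` if the category does not have Euler
characteristic. -/
noncomputable def eulerChar (C : Type*) [Category C] [Fintype C] : ℚ :=
  if h : HasEulerChar C then ∑ a, h.2.choose a else 0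

theorem sum_weighting_eq_sum_coweighting {C : Type*} [Category C] [Fintype C] {k l : C → ℚ}
    (hk : IsWeighting C k) (hl : IsCoweighting C l) : ∑ b, k b = ∑ a, l a := by
  have h1 : ∑ b, k b = ∑ b, ∑ a, l a * zetaMatrix C a b * k b :=
    Finset.sum_congr rfl fun b _ => by rw [← Finset.sum_mul, hl b, one_mul]
  have h2 : ∑ a, l a = ∑ a, ∑ b, l a * zetaMatrix C a b * k b :=
    Finset.sum_congr rfl fun a _ => by
      simp_rw [mul_assoc]
      rw [← Finset.mul_sum, hk a, mul_one]
  rw [h1, h2, Finset.sum_comm]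

theorem eulerChar_eq_sum_weighting {C : Type*} [Category C] [Fintype C]
    (h : HasEulerChar C) {k : C → ℚ} (hk : IsWeighting C k) : eulerChar C = ∑ a, k a := by
  rw [eulerChar, dif_pos h]
  exact (sum_weighting_eq_sum_coweighting hk h.2.choose_spec).symm

theorem eulerChar_eq_sum_coweighting {C : Type*} [Category C] [Fintype C]
    (h : HasEulerChar C) {k : C → ℚ} (hk : IsCoweighting C k) : eulerChar C = ∑ a, k a := by
  obtain ⟨w, hw⟩ := h.1
  rw [eulerChar_eq_sum_weighting h hw, sum_weighting_eq_sum_coweighting hw hk]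

end EulerCharacteristic

/-! ### Fusion systems and abstract Frobenius categories -/

/-- A fusion system over the group `P` : for all subgroups `H`, `K` of `P` a set `hom H K` of
injective homomorphisms `H → K`, closed under composition, containing all homomorphisms that are
restrictions of inner automorphisms of `P`, and such that every member is an isomorphism of the
system followed by an inclusion. -/
structure FusionSystem (P : Type*) [Group P] where
  hom : ∀ H K : Subgroup P, Set (H →* K)
  injective : ∀ {H K : Subgroup P} {φ : H →* K}, φ ∈ hom H K → Function.Injective φ
  conj_mem : ∀ {H K : Subgroup P} (g : P) (φ : H →* K),
    (∀ x : H, (φ x : P) = g * (x : P) * g⁻¹) → φ ∈ hom H K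
  comp_mem : ∀ {H K L : Subgroup P} {φ : H →* K} {ψ : K →* L},
    φ ∈ hom H K → ψ ∈ hom K L → ψ.comp φ ∈ hom H L
  factor : ∀ {H K : Subgroup P} {φ : H →* K}, φ ∈ hom H K →
    ∃ (L : Subgroup P) (hL : L ≤ K) (ψ : H ≃* L),
      ψ.toMonoidHom ∈ hom H L ∧ ψ.symm.toMonoidHom ∈ hom L H ∧
      φ = (Subgroup.inclusion hL).comp ψ.toMonoidHom

namespace FusionSystem

variable {P : Type*} [Group P] (F : FusionSystem P)

theorem id_mem (H : Subgroup P) : MonoidHom.id H ∈ F.hom H H :=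
  F.conj_mem 1 _ fun x => by simp

theorem symm_mem {H K : Subgroup P} {φ : H ≃* K} (h : φ.toMonoidHom ∈ F.hom H K) :
    φ.symm.toMonoidHom ∈ F.hom K H := by
  obtain ⟨L, hL, ψ, -, h2, h3⟩ := F.factor h
  have hφ : ∀ x, φ x = Subgroup.inclusion hL (ψ x) := fun x => DFunLike.congr_fun h3 x
  obtain rfl : L = K := by
    refine le_antisymm hL fun y hy => ?_
    have h4 := hφ (φ.symm ⟨y, hy⟩)
    rw [MulEquiv.apply_symm_apply] at h4
    have h5 : y = (ψ (φ.symm ⟨y, hy⟩) : P) := congrArg Subtype.val h4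
    rw [h5]
    exact (ψ (φ.symm ⟨y, hy⟩)).2
  obtain rfl : φ = ψ := MulEquiv.ext fun x => hφ x
  exact h2

/-- The objects of the category `F` : all subgroups of `P`. -/
structure Obj (F : FusionSystem P) where
  toSubgroup : Subgroup P

instance : Category F.Obj where
  Hom H K := F.hom H.toSubgroup K.toSubgroup
  id H := ⟨MonoidHom.id _, F.id_mem _⟩
  comp φ ψ := ⟨ψ.1.comp φ.1, F.comp_mem φ.2 ψ.2⟩

/-- The objects of the category `F*`, the full subcategory of `F` generated by all nonidentity
subgroups of `P`. -/
abbrev Star : Type _ := ObjectProperty.FullSubcategory fun H : F.Obj => H.toSubgroup ≠ ⊥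

instance [Finite P] : Finite F.Star :=
  Finite.of_injective (fun H : F.Star => H.obj.toSubgroup) (by
    rintro ⟨⟨H⟩, _⟩ ⟨⟨K⟩, _⟩ h
    cases h
    rfl)

noncomputable instance [Finite P] : Fintype F.Star := Fintype.ofFinite _

/-- The isomorphism classes of objects of `F*`. -/
abbrev StarClasses : Type _ := Quotient (isIsomorphicSetoid F.Star)

noncomputable instance [Finite P] : Fintype F.StarClasses := Fintype.ofFinite _

/-- Two subgroups of `P` are `F`-conjugate if they are isomorphic objects of `F`. -/
def IsConjugate (H K : Subgroup P) : Prop :=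
  ∃ φ : H ≃* K, φ.toMonoidHom ∈ F.hom H K

/-- `H` is fully centralized in `F` if `|C_P(H)| ≥ |C_P(K)|` for all `K` that are
`F`-conjugate to `H`. -/
def IsFullyCentralized (H : Subgroup P) : Prop :=
  ∀ K : Subgroup P, F.IsConjugate H K →
    Nat.card (Subgroup.centralizer (K : Set P)) ≤ Nat.card (Subgroup.centralizer (H : Set P))

/-- `H` is fully normalized in `F` if `|N_P(H)| ≥ |N_P(K)|` for all `K` that are
`F`-conjugate to `H`. -/
def IsFullyNormalized (H : Subgroup P) : Prop :=
  ∀ K : Subgroup P, F.IsConjugate H K →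
    Nat.card (Subgroup.normalizer (K : Set P)) ≤ Nat.card (Subgroup.normalizer (H : Set P))

/-- The group `Aut_F(H)` of automorphisms of `H` that lie in `F`. -/
def autF (H : Subgroup P) : Subgroup (MulAut H) where
  carrier := {α | MulEquiv.toMonoidHom α ∈ F.hom H H}
  one_mem' := F.id_mem H
  mul_mem' {_ _} ha hb := F.comp_mem hb ha
  inv_mem' {_} ha := F.symm_mem ha

/-- The group `Aut_P(H)` of automorphisms of `H` induced by conjugation with elements of the
normalizer `N_P(H)`. -/
def autP (H : Subgroup P) : Subgroup (MulAut H) := H.normalizerMonoidHom.range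

/-- For an isomorphism `φ : H → K`, the subgroup
`N_φ = {g ∈ N_P(H) | φ c_g φ⁻¹ ∈ Aut_P(K)}` of `P`, where `c_g` is conjugation with `g`. -/
def extender {H K : Subgroup P} (φ : H ≃* K) : Subgroup P :=
  ((autP K).comap ((MulAut.congr φ).toMonoidHom.comp H.normalizerMonoidHom)).map
    (Subgroup.normalizer (H : Set P)).subtype

theorem le_extender {H K : Subgroup P} (φ : H ≃* K) : H ≤ extender φ := by
  intro x hx
  refine ⟨⟨x, Subgroup.le_normalizer hx⟩, ?_, rfl⟩
  refine ⟨⟨φ ⟨x, hx⟩, Subgroup.le_normalizer (φ ⟨x, hx⟩).2⟩, ?_⟩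
  refine MulEquiv.ext fun y => ?_
  change φ ⟨x, hx⟩ * y * (φ ⟨x, hx⟩)⁻¹ = φ (⟨x, hx⟩ * φ.symm y * ⟨x, hx⟩⁻¹)
  simp

/-- Saturation: the fusion system `F` over the finite `p`-group `P` is an (abstract) Frobenius
category. Fully normalized subgroups are fully centralized and `Aut_P(H)` is a Sylow `p`-subgroup
of `Aut_F(H)` for them; and every isomorphism `φ : H → K` of `F` with `K` fully centralized
extends to a morphism `N_φ → P` of `F`. -/
structure IsSaturated (p : ℕ) : Prop where
  fullyCentralized : ∀ H : Subgroup P, F.IsFullyNormalized H → F.IsFullyCentralized H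
  sylow : ∀ H : Subgroup P, F.IsFullyNormalized H →
    ∃ Q : Sylow p (F.autF H), (Q : Subgroup (F.autF H)) = (autP H).subgroupOf (F.autF H)
  extension : ∀ (H K : Subgroup P) (φ : H ≃* K), φ.toMonoidHom ∈ F.hom H K →
    F.IsFullyCentralized K →
    ∃ ψ ∈ F.hom (extender φ) ⊤, ∀ x : H,
      (ψ (Subgroup.inclusion (le_extender φ) x) : P) = (φ x : P)

end FusionSystem

open Classical in
/-- The Möbius function `μ(K) = μ(1, K)` of the poset of all subgroups of the finite group `P`,
at the subgroup `K`. -/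
noncomputable def subgroupMobius {P : Type*} [Group P] [Finite P] (K : Subgroup P) : ℤ :=
  letI : Fintype (Subgroup P) := Fintype.ofFinite _
  letI : LocallyFiniteOrder (Subgroup P) := Fintype.toLocallyFiniteOrder
  IncidenceAlgebra.mu ℤ (⊥ : Subgroup P) K

/-- A rational number is a `p`-local integer, that is, lies in `ℤ_(p)`, if `p` does not divide
its reduced denominator. -/
def IsPLocalInteger (p : ℕ) (q : ℚ) : Prop := ¬ p ∣ q.den

/-! A morphism `K → H` is an automorphism of `K` followed by a chosen isomorphism onto its image, so
`|F(K, H)|` is `|F(K)|` times the number of conjugates of `K` inside `H` (`card_hom`). With `H = P`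
this turns `k_K |F(K, H)|` into `-μ(K)` times the proportion of the conjugates of `K` that lie in
`H`. As `μ` is constant on isomorphism classes, summing over `K` gives `-∑ μ(L)` over `1 ≠ L ≤ H`,
which is `μ(1) = 1`. Summing `k_K` over one class gives `-μ(K) / |F(K)|`. A weighting exists because
the `ζ`-matrix is block triangular for the order of subgroups.

For `p`-locality, the `p`-part of `|F(K)|` has to divide `μ(K)`. This follows from
`IsPGroup.card_dvd_subgroupMobius_top`: if a `p`-group `Q` acts faithfully on a `p`-group `G`, then
`|Q|` divides `μ(G)`. Weisner's theorem for `Z = C_G(Q) ≠ 1` expresses `μ(G)` through proper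
subgroups `L` with `L ⊔ Z = G`. The stabilizer of such an `L` still acts faithfully on `L`, so
induction and counting along orbits finish the argument. -/

/-! ### The Möbius function of the subgroup poset -/

section SubgroupMobius

open Classical in
theorem sum_subgroupMobius_le {G : Type*} [Group G] [Finite G] [Fintype (Subgroup G)]
    (K : Subgroup G) :
    ∑ L with L ≤ K, subgroupMobius L = if K = ⊥ then 1 else 0 := by
  -- The same instance as in the definition of `subgroupMobius`, so that the summands agree by
  -- `rfl`.
  let : LocallyFiniteOrder (Subgroup G) :=
    @Fintype.toLocallyFiniteOrder _ _ (Fintype.ofFinite _) _ _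
  have h := IncidenceAlgebra.sum_Icc_mu_right (𝕜 := ℤ) (⊥ : Subgroup G) K
  rw [eq_comm (a := K), ← h]
  refine Finset.sum_congr ?_ fun L _ => rfl
  ext L
  simp

-- The recursion for `μ`, which allows lattices to be compared by induction.
open Classical in
theorem subgroupMobius_eq {G : Type*} [Group G] [Finite G] [Fintype (Subgroup G)]
    (K : Subgroup G) :
    subgroupMobius K = (if K = ⊥ then 1 else 0) - ∑ L with L < K, subgroupMobius L := by
  rw [← sum_subgroupMobius_le, eq_sub_iff_add_eq, ← Finset.sum_insert (by simp)]
  refine Finset.sum_congr ?_ fun _ _ => rfl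
  ext L
  simp [le_iff_eq_or_lt]

theorem subgroupMobius_bot (G : Type*) [Group G] [Finite G] :
    subgroupMobius (⊥ : Subgroup G) = 1 := by
  have := Fintype.ofFinite (Subgroup G)
  rw [subgroupMobius_eq]
  simp

open Classical in
theorem sum_subgroupMobius_le_ne_bot {G : Type*} [Group G] [Finite G] [Fintype (Subgroup G)]
    {K : Subgroup G} (hK : K ≠ ⊥) :
    ∑ L with L ≤ K ∧ L ≠ ⊥, subgroupMobius L = -1 := by
  have h := sum_subgroupMobius_le K
  rw [if_neg hK, ← Finset.sum_filter_add_sum_filter_not _ (· ≠ ⊥), Finset.filter_filter,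
    Finset.filter_filter] at h
  have h2 : (Finset.univ.filter fun L : Subgroup G => L ≤ K ∧ ¬ L ≠ ⊥) = {⊥} := by
    ext L
    simp +contextual
  rw [h2, Finset.sum_singleton, subgroupMobius_bot] at h
  linarith

/-- The Möbius number of a subgroup depends only on its lattice of subgroups. -/
theorem subgroupMobius_eq_of_orderIso {G G' : Type*} [Group G] [Finite G] [Group G'] [Finite G']
    {K : Subgroup G} {K' : Subgroup G'} (e : Set.Iic K ≃o Set.Iic K') (J : Set.Iic K) :
    subgroupMobius (J : Subgroup G) = subgroupMobius (e J : Subgroup G') := by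
  classical
  have := Fintype.ofFinite (Subgroup G)
  have := Fintype.ofFinite (Subgroup G')
  induction J using WellFoundedLT.induction with
  | ind J ih =>
    have hbot : ((J : Subgroup G) = ⊥) ↔ ((e J : Subgroup G') = ⊥) := by
      rw [← Set.Iic.coe_bot (a := K), ← Set.Iic.coe_bot (a := K'), Subtype.coe_inj,
        Subtype.coe_inj, map_eq_bot_iff]
    rw [subgroupMobius_eq (J : Subgroup G), subgroupMobius_eq (e J : Subgroup G')]
    simp only [hbot]
    congr 1
    refine Finset.sum_bij'
      (fun L hL => (e ⟨L, (Finset.mem_filter.1 hL).2.le.trans J.2⟩ : Subgroup G'))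
      (fun L hL => (e.symm ⟨L, (Finset.mem_filter.1 hL).2.le.trans (e J).2⟩ : Subgroup G))
      ?_ ?_ ?_ ?_ ?_
    · intro L hL
      have hL' := (Finset.mem_filter.1 hL).2
      exact Finset.mem_filter.2 ⟨Finset.mem_univ _,
        e.lt_iff_lt.2 (show (⟨L, hL'.le.trans J.2⟩ : Set.Iic K) < J from hL')⟩
    · intro L hL
      have hL' := (Finset.mem_filter.1 hL).2
      refine Finset.mem_filter.2 ⟨Finset.mem_univ _, ?_⟩
      have := e.symm.lt_iff_lt.2 (show (⟨L, hL'.le.trans (e J).2⟩ : Set.Iic K') < e J from hL')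
      rw [e.symm_apply_apply] at this
      exact this
    · intro L hL
      exact congrArg Subtype.val (e.symm_apply_apply _)
    · intro L hL
      exact congrArg Subtype.val (e.apply_symm_apply _)
    · intro L hL
      have hL' := (Finset.mem_filter.1 hL).2
      exact ih ⟨L, hL'.le.trans J.2⟩ hL'

theorem subgroupMobius_congr {G G' : Type*} [Group G] [Finite G] [Group G'] [Finite G']
    {K : Subgroup G} {K' : Subgroup G'} (e : K ≃* K') :
    subgroupMobius K = subgroupMobius K' := by
  let o : Set.Iic K ≃o Set.Iic K' := (Subgroup.MapSubtype.orderIso K).symm.trans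
    (e.mapSubgroup.trans (Subgroup.MapSubtype.orderIso K'))
  have h := subgroupMobius_eq_of_orderIso o ⊤
  rwa [map_top] at h

open Classical in
/-- Weisner's theorem for the subgroup poset. -/
theorem sum_subgroupMobius_sup_eq {G : Type*} [Group G] [Finite G] [Fintype (Subgroup G)]
    {Z : Subgroup G} (hZ : Z ≠ ⊥) (K : Subgroup G) (hK : Z ≤ K) :
    ∑ L with L ⊔ Z = K, subgroupMobius L = 0 := by
  induction K using WellFoundedLT.induction with
  | ind K ih =>
    -- The vanishing sum over `L ≤ K` is split by the value `J` of `L ⊔ Z`; the fibres with `J < K`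
    -- vanish by induction, leaving the fibre over `K`.
    have h := sum_subgroupMobius_le K
    rw [if_neg (ne_bot_of_le_ne_bot hZ hK),
      ← Finset.sum_fiberwise_of_maps_to (t := Finset.univ.filter fun J => Z ≤ J ∧ J ≤ K)
        (g := fun L => L ⊔ Z)
        (fun L hL => by simpa [hK] using hL), Finset.sum_eq_single K] at h
    · rw [← h, Finset.filter_filter]
      refine Finset.sum_congr (Finset.filter_congr fun L _ => ?_) fun _ _ => rfl
      exact ⟨fun h => ⟨h ▸ le_sup_left, h⟩, fun h => h.2⟩
    · intro J hJ hne
      have hJ' := (Finset.mem_filter.1 hJ).2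
      rw [← ih J (lt_of_le_of_ne hJ'.2 hne) hJ'.1, Finset.filter_filter]
      refine Finset.sum_congr (Finset.filter_congr fun L _ => ?_) fun _ _ => rfl
      exact ⟨fun h => h.2, fun h => ⟨(h ▸ le_sup_left : L ≤ J).trans hJ'.2, h⟩⟩
    · intro h
      simp [hK] at h

end SubgroupMobius

/-! ### Divisibility of Möbius numbers by the orders of `p`-groups of automorphisms -/

/-- If `f` is invariant under a finite group `Q` and its values are divisible by the orders of the
stabilizers, then the sum of its values is divisible by the order of `Q`. -/
theorem card_dvd_sum_of_card_stabilizer_dvd {Q α : Type*} [Group Q] [Finite Q] [MulAction Q α]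
    [Fintype α] (f : α → ℤ) (hf : ∀ (q : Q) a, f (q • a) = f a)
    (hdvd : ∀ a, (Nat.card (MulAction.stabilizer Q a) : ℤ) ∣ f a) :
    (Nat.card Q : ℤ) ∣ ∑ a, f a := by
  classical
  rw [← Finset.sum_fiberwise Finset.univ
    (fun a => (Quotient.mk (MulAction.orbitRel Q α) a)) f]
  refine Finset.dvd_sum fun c _ => ?_
  induction c using Quotient.inductionOn with
  | h a =>
    have hmem : ∀ b, b ∈ Finset.univ.filter (fun b =>
        Quotient.mk (MulAction.orbitRel Q α) b = Quotient.mk _ a) ↔ b ∈ MulAction.orbit Q a := by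
      intro b
      rw [Finset.mem_filter, Quotient.eq, MulAction.orbitRel_apply]
      simp
    -- The orbit of `a` contributes its length times `f a`, a multiple of length times stabilizer
    -- order, which is `|Q|`.
    rw [Finset.sum_congr rfl (g := fun _ => f a), Finset.sum_const, nsmul_eq_mul]
    · have hc : (Finset.univ.filter (fun b =>
          Quotient.mk (MulAction.orbitRel Q α) b = Quotient.mk _ a)).card
          = Nat.card (MulAction.orbit Q a) := by
        rw [← Nat.card_congr (Equiv.subtypeEquivRight hmem), Nat.card_eq_fintype_card,
          Fintype.card_coe]
      obtain ⟨t, ht⟩ := hdvd a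
      have := Fintype.ofFinite Q
      have hos := MulAction.card_orbit_mul_card_stabilizer_eq_card_group Q a
      rw [← Nat.card_eq_fintype_card, ← Nat.card_eq_fintype_card,
        ← Nat.card_eq_fintype_card] at hos
      rw [hc, ht, ← hos]
      exact ⟨t, by push_cast; ring⟩
    · intro b hb
      obtain ⟨q, rfl⟩ := (hmem b).1 hb
      exact hf q a

open scoped Pointwise in
/-- The order of a `p`-group acting faithfully on a finite `p`-group `G` divides the Möbius number
of `G`. -/
theorem IsPGroup.card_dvd_subgroupMobius_top {p : ℕ} [Fact p.Prime] {G Q : Type*} [Group G]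
    [Finite G] (hG : IsPGroup p G) [Group Q] [Finite Q] (hQ : IsPGroup p Q)
    [MulDistribMulAction Q G] [FaithfulSMul Q G] :
    (Nat.card Q : ℤ) ∣ subgroupMobius (⊤ : Subgroup G) := by
  classical
  induction hn : Nat.card G using Nat.strong_induction_on generalizing G Q with
  | _ n ih =>
  subst hn
  rcases subsingleton_or_nontrivial G with hs | hs
  · have : Subsingleton Q := ⟨fun a b => FaithfulSMul.eq_of_smul_eq_smul
      fun x : G => Subsingleton.elim _ _⟩
    rw [Nat.card_of_subsingleton (1 : Q)]
    exact one_dvd _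
  have := Fintype.ofFinite (Subgroup G)
  let Z : Subgroup G := FixedPoints.subgroup Q G
  have hZ : Z ≠ ⊥ := by
    obtain ⟨k, hk, hcard⟩ := hG.nontrivial_iff_card.1 hs
    -- The number of fixed points is divisible by `p`, so `1` is not the only one.
    obtain ⟨b, hb, hne⟩ := hQ.exists_fixed_point_of_prime_dvd_card_of_fixed_point G (p := p)
      (hcard ▸ dvd_pow_self p hk.ne') (a := 1) (fun q => smul_one q)
    intro h
    exact hne ((Subgroup.mem_bot.1 (h ▸ (show b ∈ Z from hb))).symm)
  have hsmulZ : ∀ q : Q, q • Z = Z := by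
    intro q
    ext z
    rw [Subgroup.mem_pointwise_smul_iff_inv_smul_mem]
    constructor
    · intro h
      have h2 : q • q⁻¹ • z = q⁻¹ • z := h q
      rw [smul_inv_smul] at h2
      rwa [h2]
    · intro h
      rwa [show q⁻¹ • z = z from h q⁻¹]
  have htop : ∀ q : Q, q • (⊤ : Subgroup G) = ⊤ := fun q => by
    ext x
    simp [Subgroup.mem_pointwise_smul_iff_inv_smul_mem]
  -- The term `L = ⊤` of Weisner's sum is isolated; the rest runs over proper `L`, and `Q` permutes
  -- these because it fixes `Z`.
  have hsum := sum_subgroupMobius_sup_eq hZ ⊤ le_top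
  rw [← Finset.add_sum_erase _ _ (show ⊤ ∈ _ by simp)] at hsum
  rw [eq_neg_of_add_eq_zero_left hsum, dvd_neg]
  have hset : (Finset.univ.filter fun L : Subgroup G => L ⊔ Z = ⊤).erase ⊤ =
      Finset.univ.filter fun L : Subgroup G => L ⊔ Z = ⊤ ∧ L ≠ ⊤ := by
    ext L
    simp [and_comm]
  rw [hset, Finset.sum_filter]
  refine card_dvd_sum_of_card_stabilizer_dvd (Q := Q) _ ?_ ?_
  · intro q L
    have h1 : q • L ⊔ Z = ⊤ ↔ L ⊔ Z = ⊤ := by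
      conv_lhs => rw [← hsmulZ q, ← Subgroup.smul_sup]
      rw [smul_eq_iff_eq_inv_smul, htop]
    have h2 : q • L = ⊤ ↔ L = ⊤ := by
      rw [smul_eq_iff_eq_inv_smul, htop]
    rw [subgroupMobius_congr (Subgroup.equivSMul q L).symm]
    simp [h1, h2]
  · intro L
    split_ifs with hL
    swap
    · exact dvd_zero _
    have hstab : ∀ (q : MulAction.stabilizer Q L) (x : L), (q : Q) • (x : G) ∈ L := by
      intro q x
      have := Subgroup.smul_mem_pointwise_smul (x : G) (q : Q) L x.2
      rwa [q.2] at this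
    let : MulDistribMulAction (MulAction.stabilizer Q L) L :=
      { smul := fun q x => ⟨(q : Q) • (x : G), hstab q x⟩
        one_smul := fun x => Subtype.ext (one_smul Q (x : G))
        mul_smul := fun a b x => Subtype.ext (mul_smul (a : Q) (b : Q) (x : G))
        smul_mul := fun a x y => Subtype.ext (smul_mul' (a : Q) (x : G) (y : G))
        smul_one := fun a => Subtype.ext (smul_one (a : Q)) }
    have hfaith : FaithfulSMul (MulAction.stabilizer Q L) L := by
      refine ⟨fun {a b} hab => Subtype.ext (FaithfulSMul.eq_of_smul_eq_smul (α := G) ?_)⟩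
      -- Elements that agree on `L` also agree on `Z`, where both act trivially, hence on `L ⊔ Z =
      -- G`.
      have hle : L ⊔ Z ≤ (MulDistribMulAction.toMonoidHom G (a : Q)).eqLocus
          (MulDistribMulAction.toMonoidHom G (b : Q)) :=
        sup_le (fun x hx => congrArg Subtype.val (hab ⟨x, hx⟩))
          fun z hz => (hz (a : Q)).trans (hz (b : Q)).symm
      intro x
      exact hle (hL.1 ▸ Subgroup.mem_top x)
    have hlt : Nat.card L < Nat.card G :=
      lt_of_le_of_ne (Subgroup.card_le_card_group L) fun h => hL.2 (Subgroup.eq_top_of_card_eq L h)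
    have := ih (Nat.card L) hlt (hG.to_subgroup L) (hQ.to_subgroup (MulAction.stabilizer Q L)) rfl
    rwa [subgroupMobius_congr (Subgroup.topEquiv (G := L))] at this

/-! ### `p`-local integers -/

/-- Cancelling the full power of `p` in `n` leaves a denominator prime to `p`, and the reduced
denominator divides it. -/
theorem isPLocalInteger_div {p : ℕ} [Fact p.Prime] (a : ℤ) {n : ℕ} (hn : n ≠ 0)
    (h : ∀ k, p ^ k ∣ n → ((p ^ k : ℕ) : ℤ) ∣ a) : IsPLocalInteger p ((a : ℚ) / n) := by
  have hp : p.Prime := Fact.out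
  obtain ⟨k, m, hm, rfl⟩ := Nat.exists_eq_pow_mul_and_not_dvd hn p hp.ne_one
  obtain ⟨t, rfl⟩ := h k (dvd_mul_right _ _)
  have hpk : ((p ^ k : ℕ) : ℚ) ≠ 0 := by exact_mod_cast pow_ne_zero k hp.ne_zero
  have heq : (((p ^ k : ℕ) * t : ℤ) : ℚ) / ((p ^ k * m : ℕ) : ℚ) = (t : ℚ) / ((m : ℤ) : ℚ) := by
    push_cast at hpk ⊢
    rw [mul_div_mul_left _ _ hpk]
  intro hd
  rw [heq, ← Rat.divInt_eq_div] at hd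
  exact hm (Int.natCast_dvd_natCast.1 ((Int.natCast_dvd_natCast.2 hd).trans (Rat.den_dvd t m)))

theorem isPLocalInteger_sum {p : ℕ} [Fact p.Prime] {ι : Type*} (s : Finset ι) (f : ι → ℚ)
    (h : ∀ i ∈ s, IsPLocalInteger p (f i)) : IsPLocalInteger p (∑ i ∈ s, f i) := by
  have hp : p.Prime := Fact.out
  refine Finset.sum_induction f (IsPLocalInteger p) (fun a b ha hb hab => ?_) ?_ h
  · rcases hp.dvd_mul.1 (hab.trans (Rat.add_den_dvd a b)) with h | h
    exacts [ha h, hb h]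
  · simpa [IsPLocalInteger] using hp.ne_one

/-! ### Existence of weightings -/

/-- A finite category with finite morphism sets has a weighting if its objects are graded in such
a way that every morphism between nonisomorphic objects raises the degree. -/
theorem exists_isWeighting_of_rank {C : Type*} [Category C] [Fintype C]
    (hfin : ∀ a b : C, Finite (a ⟶ b)) (r : C → ℕ) (hiso : ∀ a b : C, Nonempty (a ≅ b) → r a = r b)
    (hr : ∀ a b : C, Nonempty (a ⟶ b) → r a < r b ∨ Nonempty (a ≅ b)) :
    ∃ k, IsWeighting C k := by
  classical
  -- The row sum of the diagonal block of `a`: a solution constant on isomorphism classes only has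
  -- to divide by it.
  let D : C → ℚ := fun a => ∑ b with Nonempty (a ≅ b), zetaMatrix C a b
  have hD0 : ∀ a, D a ≠ 0 := by
    intro a
    refine (Finset.sum_pos' (fun _ _ => Nat.cast_nonneg _) ⟨a, by simpa using ⟨Iso.refl a⟩, ?_⟩).ne'
    have := hfin a a
    have : Nonempty (a ⟶ a) := ⟨𝟙 a⟩
    exact Nat.cast_pos.2 Nat.card_pos
  have hζ : ∀ {a a' : C} (b : C), (a ≅ a') → zetaMatrix C a b = zetaMatrix C a' b :=
    fun b e => congrArg Nat.cast (Nat.card_congr (Iso.homCongr e (Iso.refl b)))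
  have hD : ∀ {a a' : C}, (a ≅ a') → D a = D a' := by
    intro a a' e
    refine Finset.sum_congr (Finset.filter_congr fun b _ => ?_) fun b _ => hζ b e
    exact ⟨fun ⟨f⟩ => ⟨e.symm ≪≫ f⟩, fun ⟨f⟩ => ⟨e ≪≫ f⟩⟩
  have hwf : WellFounded fun b a : C => r a < r b :=
    @Finite.wellFounded_of_trans_of_irrefl C _ (fun b a => r a < r b)
      ⟨fun _ _ _ h h' => h'.trans h⟩ ⟨fun _ => lt_irrefl _⟩
  -- Back substitution from the highest degree downwards.
  let k : C → ℚ := hwf.fix fun a ih =>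
    (1 - ∑ b, if h : r a < r b then zetaMatrix C a b * ih b h else 0) / D a
  have hk : ∀ a, k a = (1 - ∑ b with r a < r b, zetaMatrix C a b * k b) / D a := by
    intro a
    rw [Finset.sum_filter]
    exact hwf.fix_eq _ a
  have hkiso : ∀ {a a' : C}, (a ≅ a') → k a' = k a := by
    intro a a' e
    rw [hk, hk a, hD e]
    congr 2
    refine Finset.sum_congr (Finset.filter_congr fun b _ => ?_) fun b _ => ?_
    · rw [hiso a a' ⟨e⟩]
    · rw [hζ b e]
  refine ⟨k, fun a => ?_⟩
  have hsplit : ∑ b, zetaMatrix C a b * k b =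
      ∑ b with r a < r b, zetaMatrix C a b * k b + D a * k a := by
    rw [← Finset.sum_filter_add_sum_filter_not _ (fun b => r a < r b)]
    congr 1
    rw [Finset.sum_mul]
    symm
    -- An object that is neither of higher degree than `a` nor isomorphic to `a` receives no
    -- morphism from `a`.
    refine Finset.sum_subset_zero_on_sdiff ?_ ?_ ?_
    · intro b hb
      have h := hiso a b (Finset.mem_filter.1 hb).2
      simp [h]
    · intro b hb
      simp only [Finset.mem_sdiff, Finset.mem_filter, Finset.mem_univ, true_and] at hb
      have : IsEmpty (a ⟶ b) := not_nonempty_iff.1 fun h => (hr a b h).elim hb.1 hb.2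
      simp [zetaMatrix]
    · intro b hb
      rw [hkiso (Finset.mem_filter.1 hb).2.some]
  rw [hsplit, hk a, mul_div_cancel₀ _ (hD0 a)]
  ring

/-! ### Morphism sets of a fusion system -/

namespace FusionSystem

variable {P : Type*} [Group P] (F : FusionSystem P)

theorem finite_hom [Finite P] (H K : F.Obj) : Finite (H ⟶ K) := by
  have : Finite (H.toSubgroup →* K.toSubgroup) := DFunLike.finite _
  exact inferInstanceAs (Finite (F.hom H.toSubgroup K.toSubgroup))

theorem isConjugate_iff_nonempty_iso (H K : F.Star) :
    F.IsConjugate H.obj.toSubgroup K.obj.toSubgroup ↔ Nonempty (H ≅ K) := by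
  constructor
  · rintro ⟨φ, hφ⟩
    refine ⟨ObjectProperty.isoMk _ ⟨⟨φ.toMonoidHom, hφ⟩, ⟨φ.symm.toMonoidHom, F.symm_mem hφ⟩,
      ?_, ?_⟩⟩
    · exact Subtype.ext (MonoidHom.ext fun x => φ.symm_apply_apply x)
    · exact Subtype.ext (MonoidHom.ext fun x => φ.apply_symm_apply x)
  · rintro ⟨e⟩
    have h1 : e.inv.hom.1.comp e.hom.hom.1 = MonoidHom.id _ :=
      congrArg (fun f : H ⟶ H => f.hom.1) e.hom_inv_id
    have h2 : e.hom.hom.1.comp e.inv.hom.1 = MonoidHom.id _ :=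
      congrArg (fun f : K ⟶ K => f.hom.1) e.inv_hom_id
    exact ⟨MonoidHom.toMulEquiv e.hom.hom.1 e.inv.hom.1 h1 h2, e.hom.hom.2⟩

/-- Every morphism `K → H` is, for a unique `L ≤ H` that is `F`-conjugate to `K`, an
`F`-automorphism of `K` followed by a chosen isomorphism `K → L` and the inclusion. -/
theorem card_hom [Finite P] (K H : Subgroup P) :
    Nat.card (F.hom K H) =
      Nat.card {L : Subgroup P // L ≤ H ∧ F.IsConjugate K L} * Nat.card (F.hom K K) := by
  rw [← Nat.card_prod]
  refine (Nat.card_congr (Equiv.ofBijective (fun x => ⟨((Subgroup.inclusion x.1.2.1).comp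
    x.1.2.2.choose.toMonoidHom).comp x.2.1, F.comp_mem x.2.2 (F.comp_mem x.1.2.2.choose_spec
      (F.conj_mem 1 _ fun y => by simp))⟩) ⟨?_, ?_⟩)).symm
  · rintro ⟨⟨L, hL, hc⟩, α⟩ ⟨⟨L', hL', hc'⟩, β⟩ h
    have hval : ∀ y, (hc.choose (α.1 y) : P) = hc'.choose (β.1 y) := fun y =>
      congrArg (fun f : F.hom K H => (f.1 y : P)) h
    -- `L` is recovered as the image of the composite, since an injective endomorphism of the finite
    -- group `K` is onto.
    have hle : ∀ {L L' : Subgroup P} (hc : F.IsConjugate K L) (hc' : F.IsConjugate K L')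
        (α β : F.hom K K), (∀ y, (hc.choose (α.1 y) : P) = hc'.choose (β.1 y)) → L ≤ L' := by
      intro L L' hc hc' α β hval x hx
      obtain ⟨y, hy⟩ := Finite.surjective_of_injective (F.injective α.2)
        (hc.choose.symm ⟨x, hx⟩)
      have h := hval y
      rw [hy, MulEquiv.apply_symm_apply] at h
      change x = _ at h
      exact h ▸ (hc'.choose (β.1 y)).2
    obtain rfl := le_antisymm (hle hc hc' α β hval) (hle hc' hc β α fun y => (hval y).symm)
    have : α = β := Subtype.ext (MonoidHom.ext fun y =>
      hc.choose.injective (Subtype.ext (hval y)))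
    rw [this]
  · rintro ⟨φ, hφ⟩
    obtain ⟨L, hL, ψ, hψ, hψ', rfl⟩ := F.factor hφ
    have hc : F.IsConjugate K L := ⟨ψ, hψ⟩
    refine ⟨⟨⟨L, hL, hc⟩, ⟨hc.choose.symm.toMonoidHom.comp ψ.toMonoidHom,
      F.comp_mem hψ (F.symm_mem hc.choose_spec)⟩⟩, ?_⟩
    refine Subtype.ext (MonoidHom.ext fun y => Subtype.ext ?_)
    simp

theorem subgroupMobius_star_congr [Finite P] {K L : F.Star} (h : Nonempty (K ≅ L)) :
    subgroupMobius K.obj.toSubgroup = subgroupMobius L.obj.toSubgroup :=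
  subgroupMobius_congr ((F.isConjugate_iff_nonempty_iso K L).2 h).choose

-- Conjugates of a nonidentity subgroup are nonidentity, so `card_hom` may count objects of
-- `F.Star`. The target stays in `F.Obj` so that `⊤` is allowed even for trivial `P`.
open Classical in
theorem card_hom_star [Finite P] (K : F.Star) (H : Subgroup P) :
    Nat.card (K.obj ⟶ (⟨H⟩ : F.Obj)) =
      (Finset.univ.filter fun L : F.Star => L.obj.toSubgroup ≤ H ∧ Nonempty (K ≅ L)).card *
        Nat.card (K ⟶ K) := by
  have h1 : Nat.card (K ⟶ K) = Nat.card (F.hom K.obj.toSubgroup K.obj.toSubgroup) :=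
    Nat.card_congr InducedCategory.homEquiv
  rw [h1, ← Fintype.card_subtype, ← Nat.card_eq_fintype_card]
  refine (F.card_hom K.obj.toSubgroup H).trans (congrArg (· * _) (Nat.card_congr ?_)).symm
  refine Equiv.ofBijective (fun L => ⟨L.1.obj.toSubgroup, L.2.1,
    (F.isConjugate_iff_nonempty_iso K L.1).2 L.2.2⟩) ⟨?_, ?_⟩
  · rintro ⟨⟨⟨L⟩, _⟩, _⟩ ⟨⟨⟨L'⟩, _⟩, _⟩ h
    cases congrArg Subtype.val h
    rfl
  · rintro ⟨L, hL, hc⟩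
    have hne : L ≠ ⊥ := by
      rintro rfl
      have := hc.choose.toEquiv.subsingleton
      exact K.2 (Subgroup.eq_bot_of_subsingleton _)
    exact ⟨⟨⟨⟨L⟩, hne⟩, hL, (F.isConjugate_iff_nonempty_iso K ⟨⟨L⟩, hne⟩).1 hc⟩, rfl⟩

open Classical in
theorem card_hom_top [Finite P] (K : F.Star) :
    Nat.card (K.obj ⟶ (⟨⊤⟩ : F.Obj)) =
      (Finset.univ.filter fun L : F.Star => Nonempty (K ≅ L)).card * Nat.card (K ⟶ K) := by
  rw [card_hom_star]
  simp

open Classical in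
theorem card_isoClass_pos [Finite P] (K : F.Star) :
    0 < (Finset.univ.filter fun L : F.Star => Nonempty (K ≅ L)).card :=
  Finset.card_pos.2 ⟨K, by simpa using ⟨Iso.refl K⟩⟩

theorem finite_hom_star [Finite P] (H K : F.Star) : Finite (H ⟶ K) :=
  have := F.finite_hom H.obj K.obj
  Finite.of_equiv _ (InducedCategory.homEquiv (X := H) (Y := K)).symm

theorem card_end_pos [Finite P] (K : F.Star) : 0 < Nat.card (K ⟶ K) :=
  have := F.finite_hom_star K K
  have : Nonempty (K ⟶ K) := ⟨𝟙 K⟩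
  Nat.card_pos

/-! ### The coweighting and the Euler characteristic -/

theorem isCoweighting_star [Finite P] : IsCoweighting F.Star (fun K =>
    -(subgroupMobius K.obj.toSubgroup : ℚ) / (Nat.card (K.obj ⟶ (⟨⊤⟩ : F.Obj)) : ℚ)) := by
  classical
  intro H
  let n : F.Star → ℚ := fun K => (Finset.univ.filter fun L : F.Star => Nonempty (K ≅ L)).card
  -- The factor `|F(K)|` cancels, and the term is spread evenly over the conjugates `L ≤ H` of `K`,
  -- with `n` the size of the class.
  have hterm : ∀ K : F.Star, -(subgroupMobius K.obj.toSubgroup : ℚ) /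
      (Nat.card (K.obj ⟶ (⟨⊤⟩ : F.Obj)) : ℚ) * zetaMatrix F.Star K H =
      ∑ L : F.Star, if L.obj.toSubgroup ≤ H.obj.toSubgroup ∧ Nonempty (K ≅ L) then
        -(subgroupMobius L.obj.toSubgroup : ℚ) / n L else 0 := by
    intro K
    have hn : n K ≠ 0 := Nat.cast_ne_zero.2 (F.card_isoClass_pos K).ne'
    have ha : (Nat.card (K ⟶ K) : ℚ) ≠ 0 := Nat.cast_ne_zero.2 (F.card_end_pos K).ne'
    have hζ : zetaMatrix F.Star K H = (Finset.univ.filter fun L : F.Star =>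
        L.obj.toSubgroup ≤ H.obj.toSubgroup ∧ Nonempty (K ≅ L)).card * Nat.card (K ⟶ K) := by
      rw [← Nat.cast_mul, ← card_hom_star]
      exact congrArg Nat.cast (Nat.card_congr InducedCategory.homEquiv)
    rw [← Finset.sum_filter, Finset.sum_congr rfl
      (g := fun _ => -(subgroupMobius K.obj.toSubgroup : ℚ) / n K), Finset.sum_const,
      nsmul_eq_mul, hζ, card_hom_top, Nat.cast_mul]
    · change _ / (n K * _) * _ = _
      field_simp
    · intro L hL
      obtain ⟨-, -, ⟨e⟩⟩ := Finset.mem_filter.1 hL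
      have h1 : n L = n K := congrArg (fun s : Finset F.Star => (s.card : ℚ))
        (Finset.filter_congr fun M _ => ⟨fun ⟨f⟩ => ⟨e ≪≫ f⟩, fun ⟨f⟩ => ⟨e.symm ≪≫ f⟩⟩)
      rw [h1, F.subgroupMobius_star_congr ⟨e⟩]
  -- After the interchange, each `L ≤ H` is met once for every `K` in its class, that is, `n L`
  -- times.
  rw [Finset.sum_congr rfl fun K _ => hterm K, Finset.sum_comm]
  have hinner : ∀ L : F.Star, (∑ K : F.Star,
      if L.obj.toSubgroup ≤ H.obj.toSubgroup ∧ Nonempty (K ≅ L) then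
        -(subgroupMobius L.obj.toSubgroup : ℚ) / n L else 0) =
      if L.obj.toSubgroup ≤ H.obj.toSubgroup then -(subgroupMobius L.obj.toSubgroup : ℚ)
      else 0 := by
    intro L
    have hn : n L ≠ 0 := Nat.cast_ne_zero.2 (F.card_isoClass_pos L).ne'
    split_ifs with hL
    · have hset : (Finset.univ.filter fun K : F.Star => Nonempty (K ≅ L)) =
          Finset.univ.filter fun K : F.Star => Nonempty (L ≅ K) :=
        Finset.filter_congr fun K _ => ⟨fun ⟨f⟩ => ⟨f.symm⟩, fun ⟨f⟩ => ⟨f.symm⟩⟩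
      simp only [hL, true_and]
      rw [← Finset.sum_filter, Finset.sum_const, nsmul_eq_mul, hset]
      exact mul_div_cancel₀ _ hn
    · simp [hL]
  rw [Finset.sum_congr rfl fun L _ => hinner L, ← Finset.sum_filter]
  have := Fintype.ofFinite (Subgroup P)
  have hsum := sum_subgroupMobius_le_ne_bot H.2
  rw [← neg_inj, ← Finset.sum_neg_distrib, ← Int.cast_one, ← Int.cast_neg, ← hsum, Int.cast_sum]
  refine Finset.sum_bij (fun L _ => L.obj.toSubgroup) ?_ ?_ ?_ ?_
  · intro L hL
    exact Finset.mem_filter.2 ⟨Finset.mem_univ _, (Finset.mem_filter.1 hL).2, L.2⟩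
  · rintro ⟨⟨L⟩, _⟩ _ ⟨⟨L'⟩, _⟩ _ h
    cases h
    rfl
  · intro L hL
    have hL' := (Finset.mem_filter.1 hL).2
    exact ⟨⟨⟨L⟩, hL'.2⟩, Finset.mem_filter.2 ⟨Finset.mem_univ _, hL'.1⟩, rfl⟩
  · intro L _
    exact neg_neg _

/-- Graded by group order: an injective morphism between groups of equal order is an isomorphism. -/
theorem hasEulerChar_star [Finite P] : HasEulerChar F.Star := by
  refine ⟨exists_isWeighting_of_rank F.finite_hom_star (fun K => Nat.card K.obj.toSubgroup)
    ?_ ?_, _, F.isCoweighting_star⟩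
  · intro K L h
    exact Nat.card_congr ((F.isConjugate_iff_nonempty_iso K L).2 h).choose.toEquiv
  · rintro K L ⟨f⟩
    have hinj := F.injective f.hom.2
    rcases (Nat.card_le_card_of_injective _ hinj).lt_or_eq with h | h
    · exact Or.inl h
    · right
      have hbij : Function.Bijective f.hom.1 :=
        (Nat.bijective_iff_injective_and_card _).2 ⟨hinj, h⟩
      exact (F.isConjugate_iff_nonempty_iso K L).1 ⟨MulEquiv.ofBijective f.hom.1 hbij, f.hom.2⟩

/-- The coweighting is constant on a class, and the class size cancels against the same factor in
`card_hom_top`. -/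
theorem eulerChar_star_eq [Finite P] (rep : F.StarClasses → F.Star)
    (hrep : ∀ c, Quotient.mk _ (rep c) = c) :
    eulerChar F.Star = ∑ c : F.StarClasses,
      -(subgroupMobius (rep c).obj.toSubgroup : ℚ) / (Nat.card (rep c ⟶ rep c) : ℚ) := by
  classical
  rw [eulerChar_eq_sum_coweighting F.hasEulerChar_star F.isCoweighting_star,
    ← Finset.sum_fiberwise Finset.univ
      (fun K : F.Star => (Quotient.mk _ K : F.StarClasses))]
  refine Finset.sum_congr rfl fun c _ => ?_
  have hset : (Finset.univ.filter fun K : F.Star => (Quotient.mk _ K : F.StarClasses) = c) =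
      Finset.univ.filter fun K : F.Star => Nonempty (rep c ≅ K) := by
    refine Finset.filter_congr fun K _ => ?_
    conv_lhs => rw [← hrep c, eq_comm]
    exact Quotient.eq
  have hn : ((Finset.univ.filter fun K : F.Star => Nonempty (rep c ≅ K)).card : ℚ) ≠ 0 :=
    Nat.cast_ne_zero.2 (F.card_isoClass_pos (rep c)).ne'
  have ha : (Nat.card (rep c ⟶ rep c) : ℚ) ≠ 0 :=
    Nat.cast_ne_zero.2 (F.card_end_pos (rep c)).ne'
  rw [hset, Finset.sum_congr rfl (g := fun _ => -(subgroupMobius (rep c).obj.toSubgroup : ℚ) /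
    (Nat.card ((rep c).obj ⟶ (⟨⊤⟩ : F.Obj)) : ℚ)), Finset.sum_const, nsmul_eq_mul, card_hom_top,
    Nat.cast_mul]
  · field_simp
  · intro K hK
    obtain ⟨e⟩ := (Finset.mem_filter.1 hK).2
    have h1 : Nat.card (K.obj ⟶ (⟨⊤⟩ : F.Obj)) = Nat.card ((rep c).obj ⟶ (⟨⊤⟩ : F.Obj)) :=
      Nat.card_congr (Iso.homCongr ((ObjectProperty.ι _).mapIso e.symm) (Iso.refl _))
    rw [h1, F.subgroupMobius_star_congr ⟨e⟩]

/-! ### `p`-locality of the Euler characteristic -/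

theorem card_autF [Finite P] (K : F.Star) :
    Nat.card (F.autF K.obj.toSubgroup) = Nat.card (K ⟶ K) := by
  have h : Nat.card (K ⟶ K) = Nat.card (K.obj ⟶ K.obj) := Nat.card_congr InducedCategory.homEquiv
  rw [h]
  refine Nat.card_congr (Equiv.ofBijective (fun α => (⟨α.1.toMonoidHom, α.2⟩ : K.obj ⟶ K.obj))
    ⟨?_, ?_⟩)
  · intro α β h
    exact Subtype.ext (MulEquiv.ext fun x => congrArg (fun f => f.1 x) h)
  · rintro ⟨φ, hφ⟩
    exact ⟨⟨MulEquiv.ofBijective φ (Finite.injective_iff_bijective.1 (F.injective hφ)), hφ⟩, rfl⟩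

/-- The `p`-part of the order of the group of `F`-automorphisms of `K` divides `μ(K)`. -/
theorem pow_dvd_subgroupMobius [Finite P] {p : ℕ} [Fact p.Prime] (hP : IsPGroup p P)
    (K : F.Star) {k : ℕ} (hk : p ^ k ∣ Nat.card (K ⟶ K)) :
    ((p ^ k : ℕ) : ℤ) ∣ subgroupMobius K.obj.toSubgroup := by
  rw [← card_autF] at hk
  -- Any subgroup of order `p ^ k` serves: as a group of automorphisms it acts faithfully on `K`.
  obtain ⟨Q, hQ⟩ := Sylow.exists_subgroup_card_pow_prime p hk
  have h := (hP.to_subgroup K.obj.toSubgroup).card_dvd_subgroupMobius_top (IsPGroup.of_card hQ)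
  rwa [hQ, subgroupMobius_congr (Subgroup.topEquiv (G := K.obj.toSubgroup))] at h

theorem isPLocalInteger_eulerChar_star [Finite P] {p : ℕ} [Fact p.Prime] (hP : IsPGroup p P) :
    IsPLocalInteger p (eulerChar F.Star) := by
  rw [F.eulerChar_star_eq Quotient.out Quotient.out_eq]
  refine isPLocalInteger_sum _ _ fun c _ => ?_
  rw [← Int.cast_neg]
  exact isPLocalInteger_div _ (F.card_end_pos _).ne'
    fun k hk => (dvd_neg).2 (F.pow_dvd_subgroupMobius hP _ hk)

end FusionSystem

theorem theorem7p2 {P : Type*} [Group P] [Finite P] (p : ℕ) [Fact p.Prime] (hP : IsPGroup p P)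
    (F : FusionSystem P) (hF : F.IsSaturated p) :
    IsCoweighting F.Star (fun K =>
      -(subgroupMobius K.obj.toSubgroup : ℚ) / (Nat.card (K.obj ⟶ (⟨⊤⟩ : F.Obj)) : ℚ)) ∧
    HasEulerChar F.Star ∧
    (∀ rep : F.StarClasses → F.Star, (∀ c, Quotient.mk _ (rep c) = c) →
      eulerChar F.Star = ∑ c : F.StarClasses,
        -(subgroupMobius (rep c).obj.toSubgroup : ℚ) / (Nat.card (rep c ⟶ rep c) : ℚ)) ∧
    IsPLocalInteger p (eulerChar F.Star) := by
  exact ⟨F.isCoweighting_star, F.hasEulerChar_star, F.eulerChar_star_eq,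
    F.isPLocalInteger_eulerChar_star hP⟩
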